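/- Let $k$ be an algebraically closed field and let $A$ be a finite-dimensional basic $k$-algebra; all modules are left modules. Let $(\Lambda,\leqslant)$ be a finite poset and $(e_\lambda)_{\lambda\in\Lambda}$ a complete set of orthogonal primitive idempotents of $A$, so that the modules $P_\lambda=Ae_\lambda$ are the pairwise non-isomorphic indecomposable projective $A$-modules, with simple tops $S_\lambda$. The standard modules are $$\Delta_\lambda=P_\lambda\Big/\sum_{\mu\not\leqslant\lambda}\mathrm{tr}_{P_\mu}(P_\lambda),$$ where $\mathrm{tr}_{P_\mu}(P_\lambda)$ is the sum of the images of all homomorphisms $P_\mu\to P_\lambda$; put $\Delta=\bigoplus_{\lambda}\Delta_\lambda$. Assume that $A$ is quasi-hereditary with respect to $\leqslant$: $[\Delta_\lambda:S_\mu]=0$ if $\mu\not\leqslant\lambda$; for every $\lambda$ the kernel of $P_\lambda\to\Delta_\lambda$ has a finite filtration with factors isomorphic to modules $\Delta_\mu$ with $\mu>\lambda$; and $\mathrm{End}_A(\Delta_\lambda)=k$ for every $\lambda$. For $\lambda\in\Lambda$ let the height $h(\lambda)\ge 1$ be the largest number of elements of a chain in $\Lambda$ with largest element $\lambda$. An $A$-module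 $M$ that has a finite filtration with factors $\Delta_\mu$ ($\mu \in \Lambda$) is generated in height $i$ if all factors $\Delta_\mu$ have $h(\mu)\ge i$ and $M/\mathrm{rad}\,M\cong\bigoplus_{h(\mu)=i}S_\mu^{\oplus m_\mu}$, where $m_\mu$ is the number of factors isomorphic to $\Delta_\mu$ (so the zero module is generated in every height). $M$ is linearly filtered if for some $i\in\mathbb N$ the $s$-th syzygy $\Omega^s(M)$ in a minimal projective resolution of $M$ is generated in height $i+s$ for all $s\ge 0$. Assume that every $\Delta_\lambda$, $\lambda\in\Lambda$, is linearly filtered. Let $\Gamma=\mathrm{Ext}_A^*(\Delta,\Delta)=\bigoplus_{n\ge0}\mathrm{Ext}^n_A(\Delta,\Delta)$ with the Yoneda product, morphisms being composed from right to left, graded by $\Gamma_n=\mathrm{Ext}^n_A(\Delta,\Delta)$. Let $1_\lambda\in\Gamma_0=\mathrm{End}_A(\Delta)$ be the projection onto $\Delta_\lambda$, and let $${}_\Gamma\Delta=\bigoplus_{\lambda\in\Lambda}{}_\Gamma\Delta_\lambda,\qquad {}_\Gamma\Delta_\lambda=\Gamma1_\lambda\Big/\sum_{\mu\not\leqslant\lambda}\mathrm{tr}_{\Gamma1_\mu}(\Gamma1_\lambda)$$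 be the direct sum of the standard $\Gamma$-modules with respect to $\leqslant$, with the grading induced from $\Gamma$. View $\Gamma_0=\Gamma/\Gamma_{\ge1}$ as a graded $\Gamma$-module. A graded $\Gamma$-module $M$ has a linear projective resolution if there is an exact sequence $\cdots\to P^1\to P^0\to M\to0$ of graded $\Gamma$-modules and degree-preserving homomorphisms, with each $P^s$ finitely generated projective and generated in degree $s$. (1) ${}_\Gamma\Delta$ and $\Gamma_0$ are isomorphic as graded $\Gamma$-modules if and only if $\mathrm{Hom}_A(\Delta_\lambda,\Delta_\mu)=0$ for all $\lambda\ne\mu$ in $\Lambda$. (2) If ${}_\Gamma\Delta$ has a linear projective resolution, then $\Gamma_0\cong{}_\Gamma\Delta$ as graded $\Gamma$-modules, and $\mathrm{Hom}_A(\Delta_\lambda,\Delta_\mu)=0$ for all $\lambda\neq\mu$ in $\Lambda$. If furthermore $\mathrm{Hom}_A(A,\Delta)\cong\mathrm{End}_A(\Delta)$ as left $\mathrm{End}_A(\Delta)$-modules, then $\Delta\cong A/\mathrm{rad}\,A$ as $A$-modules. -/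

import Mathlib

open CategoryTheory

universe u v w

/-! ### Primitive idempotents, standard modules -/

/-- A primitive idempotent: a nonzero idempotent that is not the sum of two nonzero orthogonal
idempotents. -/
def IsPrimitiveIdempotent {R : Type u} [Ring R] (e : R) : Prop :=
  IsIdempotentElem e ∧ e ≠ 0 ∧
    ∀ a b : R, IsIdempotentElem a → IsIdempotentElem b → a * b = 0 → b * a = 0 → e = a + b →
      a = 0 ∨ b = 0

/-- The left module `R e_l`, as a left ideal of `R`. -/
abbrev projModule {R : Type u} [Ring R] {Λ : Type w} (e : Λ → R) (l : Λ) : Submodule R R :=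
  Submodule.span R {e l}

/-- `e` is a complete family of orthogonal primitive idempotents such that the indecomposable
projective modules `R e_l` are pairwise non-isomorphic. For a finite-dimensional algebra `R` over
a field, the existence of such a family says that `R` is basic; then `Λ` indexes the indecomposable
projective modules `P_l = R e_l` and the simple modules `S_l = top P_l` up to isomorphism. -/
structure IsBasicFamily {R : Type u} [Ring R] {Λ : Type w} [Fintype Λ] (e : Λ → R) : Prop where
  complete : CompleteOrthogonalIdempotents e
  primitive : ∀ l, IsPrimitiveIdempotent (e l)
  basic : ∀ l m, Nonempty (projModule e l ≃ₗ[R] projModule e m) → l = m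

/-- The trace of `N` in `M`: the sum of the images of all homomorphisms `N → M`. -/
def traceIn (R : Type u) [Ring R] (N : Type v) [AddCommGroup N] [Module R N]
    (M : Type w) [AddCommGroup M] [Module R M] : Submodule R M :=
  ⨆ f : N →ₗ[R] M, LinearMap.range f

/-- The submodule `K_l = ∑_{m ≰ l} tr_{P_m}(P_l)` of `P_l = R e_l`. -/
def traceKernel {R : Type u} [Ring R] {Λ : Type w} [PartialOrder Λ] (e : Λ → R) (l : Λ) :
    Submodule R (projModule e l) :=
  ⨆ (m : Λ) (_ : ¬ m ≤ l), traceIn R (projModule e m) (projModule e l)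

/-- The standard module `Δ_l = P_l / ∑_{m ≰ l} tr_{P_m}(P_l)`, with `P_l = R e_l`. -/
abbrev Standard {R : Type u} [Ring R] {Λ : Type w} [PartialOrder Λ] (e : Λ → R) (l : Λ) : Type u :=
  projModule e l ⧸ traceKernel e l

/-- The direct sum `Δ` of all standard modules (`Λ` is finite where this is used). -/
abbrev StandardSum {R : Type u} [Ring R] {Λ : Type w} [PartialOrder Λ] (e : Λ → R) :
    Type (max u w) :=
  ∀ l, Standard e l

/-! ### Filtrations and quasi-hereditary algebras -/

/-- A finite filtration `0 = M_0 ⊆ M_1 ⊆ ⋯ ⊆ M_n = M` together with labels such that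
`M_{j+1} / M_j ≅ Δ_{label j}`. The multiplicity of `Δ_l` is the number of `j` with label `l`. -/
structure DeltaFiltration {A : Type u} [Ring A] {Λ : Type w} (Δ : Λ → Type u)
    [∀ l, AddCommGroup (Δ l)] [∀ l, Module A (Δ l)]
    (M : Type u) [AddCommGroup M] [Module A M] where
  length : ℕ
  sub : ℕ → Submodule A M
  mono : Monotone sub
  sub_zero : sub 0 = ⊥
  sub_length : sub length = ⊤
  label : Fin length → Λ
  factor : ∀ j : Fin length, Nonempty
    ((sub (j + 1) ⧸ (sub j).submoduleOf (sub (j + 1))) ≃ₗ[A] Δ (label j))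

/-- `A` is standardly stratified with respect to the partial order on `Λ`. In the first condition,
the multiplicity of the simple module `S_m = top P_m` as a composition factor of `Δ_l` vanishes if
and only if there is no nonzero homomorphism `P_m → Δ_l`. -/
structure IsStandardlyStratified {A : Type u} [Ring A] {Λ : Type w} [PartialOrder Λ]
    (e : Λ → A) : Prop where
  multiplicity_zero : ∀ l m, ¬ m ≤ l → ∀ f : projModule e m →ₗ[A] Standard e l, f = 0
  kernel_filtered : ∀ l, ∃ F : DeltaFiltration (A := A) (Standard e) (traceKernel e l),
    ∀ j, l < F.label j

/-- The `k`-algebra `A` is quasi-hereditary with respect to the partial order on `Λ`: it is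
standardly stratified and `End_A(Δ_l) = k` for every `l`. -/
structure IsQuasiHereditary (k : Type v) [Field k] {A : Type u} [Ring A] [Algebra k A]
    {Λ : Type w} [PartialOrder Λ] (e : Λ → A) : Prop extends IsStandardlyStratified e where
  end_standard : ∀ l, Function.Bijective (algebraMap k (Module.End A (Standard e l)))

/-! ### Linearly filtered modules -/

/-- The height function of a finite poset: minimal elements have height `1`, the minimal elements
among the remaining ones have height `2`, and so on; equivalently, the height of `l` is the
largest number of elements of a chain with largest element `l`. -/
noncomputable def posetHeight {Λ : Type w} [PartialOrder Λ] (l : Λ) : ℕ :=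
  (Order.height l).toNat + 1

/-- The top `M / rad M`. -/
abbrev ModTop (A : Type u) [Ring A] (M : Type v) [AddCommGroup M] [Module A M] : Type v :=
  M ⧸ Module.jacobson A M

/-- `M` has a `Δ`-filtration all of whose factors `Δ_l` have height `h(l) ≥ i`, and
`top M ≅ ⨁_{h(l) = i} S_l ^ [M : Δ_l]`, where `S_l = top Δ_l`. If `M ≠ 0` then some factor has
height `i`, so `i` is the minimal height occurring in `M`; the zero module is generated in every
height. -/
def GeneratedInHeight {A : Type u} [Ring A] {Λ : Type w} [PartialOrder Λ]
    (e : Λ → A) (i : ℕ) (M : Type u) [AddCommGroup M] [Module A M] : Prop :=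
  ∃ F : DeltaFiltration (A := A) (Standard e) M,
    (∀ j, i ≤ posetHeight (F.label j)) ∧
    Nonempty (ModTop A M ≃ₗ[A]
      ∀ j : {j : Fin F.length // posetHeight (F.label j) = i}, ModTop A (Standard e (F.label j)))

/-- `N` is the (first) syzygy of the finitely generated module `M`: the kernel of a projective
cover of `M`. -/
def IsSyzygy (A : Type u) [Ring A] (M : Type u) [AddCommGroup M] [Module A M]
    (N : Type u) [AddCommGroup N] [Module A N] : Prop :=
  ∃ (Q : ModuleCat.{u} A) (p : Q →ₗ[A] M),
    Module.Finite A Q ∧ Module.Projective A Q ∧ Function.Surjective p ∧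
    (∀ L : Submodule A Q, L ⊔ LinearMap.ker p = ⊤ → L = ⊤) ∧
    Nonempty (LinearMap.ker p ≃ₗ[A] N)

/-- `M` is linearly filtered: it has a `Δ`-filtration and, for some `i`, the `s`-th (relative)
syzygy of `M` is generated in height `i + s` for all `s ≥ 0`. The relative projective modules are
the summands of the finite direct sums of copies of `A`, so the relative syzygies are the ordinary
ones. -/
def IsLinearlyFiltered {A : Type u} [Ring A] {Λ : Type w} [PartialOrder Λ]
    (e : Λ → A) (M : Type u) [AddCommGroup M] [Module A M] : Prop :=
  ∃ (i : ℕ) (X : ℕ → ModuleCat.{u} A), Nonempty (X 0 ≃ₗ[A] M) ∧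
    ∀ s, GeneratedInHeight e (i + s) (X s) ∧ IsSyzygy A (X s) (X (s + 1))

/-! ### Graded modules and linear projective resolutions -/

/-- The subgroups `ℳ n` form a grading `M = ⨁_{n ≥ 0} ℳ n` of the module `M` over the ring `R`
graded by the subgroups `𝒜 n`. -/
structure IsModuleGrading {R : Type u} [Ring R] (𝒜 : ℕ → AddSubgroup R)
    {M : Type v} [AddCommGroup M] [Module R M] (ℳ : ℕ → AddSubgroup M) : Prop where
  internal : DirectSum.IsInternal ℳ
  smul_mem : ∀ (i j : ℕ) (a : R) (x : M), a ∈ 𝒜 i → x ∈ ℳ j → a • x ∈ ℳ (i + j)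

/-- A linear projective resolution `⋯ → P^1 → P^0 → M → 0` of the graded module `M`: an exact
sequence of graded modules and homomorphisms of degree `0`, with `P^s` finitely generated
projective and generated in degree `s`. -/
structure LinearProjectiveResolution {R : Type u} [Ring R] (𝒜 : ℕ → AddSubgroup R)
    (M : Type u) [AddCommGroup M] [Module R M] (ℳ : ℕ → AddSubgroup M) where
  P : ℕ → ModuleCat.{u} R
  deg : ∀ s, ℕ → AddSubgroup (P s)
  grading : ∀ s, IsModuleGrading 𝒜 (deg s)
  finite : ∀ s, Module.Finite R (P s)
  projective : ∀ s, Module.Projective R (P s)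
  generated : ∀ s, Submodule.span R (deg s s : Set (P s)) = ⊤
  d : ∀ s, P (s + 1) →ₗ[R] P s
  d_mem : ∀ s n x, x ∈ deg (s + 1) n → d s x ∈ deg s n
  ε : P 0 →ₗ[R] M
  ε_mem : ∀ n x, x ∈ deg 0 n → ε x ∈ ℳ n
  ε_surjective : Function.Surjective ε
  exact_zero : Function.Exact (d 0) ε
  exact_succ : ∀ s, Function.Exact (d (s + 1)) (d s)

/-- The grading of `Δ = ⨁_l Δ_l` for a graded ring `R` and homogeneous idempotents `e_l` of degree
`0`: the submodule `R e_l` of `R` inherits its grading from `R`, its quotient `Δ_l` inherits the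
quotient grading, and the direct sum is graded componentwise. -/
def standardSumDeg {R : Type u} [Ring R] (𝒜 : ℕ → AddSubgroup R)
    {Λ : Type w} [PartialOrder Λ] (e : Λ → R) (n : ℕ) : AddSubgroup (StandardSum e) :=
  AddSubgroup.pi Set.univ fun l =>
    ((𝒜 n).comap (projModule e l).subtype.toAddMonoidHom).map (traceKernel e l).mkQ.toAddMonoidHom

/-- The left ideal `R_{≥ 1}` of a graded ring `R`. -/
def positivePart {R : Type u} [Ring R] (𝒜 : ℕ → AddSubgroup R) : Submodule R R :=
  Submodule.span R {x | ∃ n, 1 ≤ n ∧ x ∈ 𝒜 n}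

/-- The degree `0` part `R_0` of a graded ring `R = ⨁_{n ≥ 0} R_n` viewed as an `R`-module, that is,
`R / R_{≥ 1}`. -/
abbrev DegreeZeroModule {R : Type u} [Ring R] (𝒜 : ℕ → AddSubgroup R) : Type u :=
  R ⧸ positivePart 𝒜

/-- The grading of `R_0 = R / R_{≥ 1}` induced by the grading of `R`. -/
def degreeZeroDeg {R : Type u} [Ring R] (𝒜 : ℕ → AddSubgroup R) (n : ℕ) :
    AddSubgroup (DegreeZeroModule 𝒜) :=
  (𝒜 n).map (positivePart 𝒜).mkQ.toAddMonoidHom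

/-- `M` and `N` are isomorphic as graded `R`-modules. -/
def GradedIso (R : Type u) [Ring R] {M : Type v} [AddCommGroup M] [Module R M]
    (ℳ : ℕ → AddSubgroup M) {N : Type w} [AddCommGroup N] [Module R N]
    (𝒩 : ℕ → AddSubgroup N) : Prop :=
  ∃ φ : M ≃ₗ[R] N, ∀ n x, x ∈ ℳ n ↔ φ x ∈ 𝒩 n

/-! ### Extension algebras -/

/-- `Ext_A^n(X, X)`. -/
abbrev ExtSelf {A : Type u} [Ring A] (X : ModuleCat.{u} A) (n : ℕ) : Type u :=
  Abelian.Ext.{u} X X n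

/-- Transport along an equality of degrees does not change `x.comp y`. -/
theorem ext_comp_mk {A : Type u} [Ring A] {X : ModuleCat.{u} A} {i j n m : ℕ}
    (x : ExtSelf X i) (y : ExtSelf X j) (hn : i + j = n) (hm : i + j = m) :
    GradedMonoid.mk (A := ExtSelf X) n (x.comp y hn) = GradedMonoid.mk m (x.comp y hm) := by
  subst hn; subst hm; rfl

/-- The Yoneda product. Morphisms are composed from right to left, that is,
`x * y` is "first `y`, then `x`". -/
noncomputable instance extGMul {A : Type u} [Ring A] (X : ModuleCat.{u} A) :
    GradedMonoid.GMul (ExtSelf X) where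
  mul {i j} x y := y.comp x (add_comm j i)

/-- The unit is the identity of `X`. -/
noncomputable instance extGOne {A : Type u} [Ring A] (X : ModuleCat.{u} A) :
    GradedMonoid.GOne (ExtSelf X) where
  one := Abelian.Ext.mk₀ (𝟙 X)

/-- The Yoneda product is associative and unital. -/
noncomputable instance extGMonoid {A : Type u} [Ring A] (X : ModuleCat.{u} A) :
    GradedMonoid.GMonoid (ExtSelf X) where
  one_mul := by
    rintro ⟨n, x⟩
    exact (ext_comp_mk x (Abelian.Ext.mk₀ (𝟙 X)) _ (add_zero n)).trans
      (congrArg (GradedMonoid.mk n) (Abelian.Ext.comp_mk₀_id x))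
  mul_one := by
    rintro ⟨n, x⟩
    exact (ext_comp_mk (Abelian.Ext.mk₀ (𝟙 X)) x _ (zero_add n)).trans
      (congrArg (GradedMonoid.mk n) (Abelian.Ext.mk₀_id_comp x))
  mul_assoc := by
    rintro ⟨a, x⟩ ⟨b, y⟩ ⟨c, z⟩
    refine (ext_comp_mk z (y.comp x (add_comm b a)) _ (by omega : _ = a + (b + c))).trans ?_
    exact congrArg (GradedMonoid.mk (A := ExtSelf X) (a + (b + c)))
      (Abelian.Ext.comp_assoc z y x (add_comm c b) (add_comm b a) (by omega)).symm

/-- The Yoneda product is biadditive, so that `⨁_n Ext_A^n(X, X)` is a ring. -/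
noncomputable instance extGRing {A : Type u} [Ring A] (X : ModuleCat.{u} A) :
    DirectSum.GRing (ExtSelf X) where
  __ := extGMonoid X
  mul_zero {i j} x := Abelian.Ext.zero_comp X j x (i + j) (add_comm j i)
  zero_mul {i j} x := Abelian.Ext.comp_zero x X i (i + j) (add_comm j i)
  mul_add _ _ _ := Abelian.Ext.add_comp _ _ _ _
  add_mul _ _ _ := Abelian.Ext.comp_add _ _ _ _
  natCast n := n • Abelian.Ext.mk₀ (𝟙 X)
  natCast_zero := zero_smul _ _
  natCast_succ _ := succ_nsmul _ _
  intCast n := n • Abelian.Ext.mk₀ (𝟙 X)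
  intCast_ofNat _ := natCast_zsmul _ _
  intCast_negSucc_ofNat _ := negSucc_zsmul _ _

/-- The extension algebra `Ext_A^*(X, X) = ⨁_n Ext_A^n(X, X)`. -/
abbrev ExtAlgebra {A : Type u} [Ring A] (X : ModuleCat.{u} A) : Type u :=
  DirectSum ℕ (ExtSelf X)

/-- The natural grading of `Ext_A^*(X, X)`. -/
noncomputable def extDeg {A : Type u} [Ring A] (X : ModuleCat.{u} A) (n : ℕ) :
    AddSubgroup (ExtAlgebra X) :=
  (DirectSum.of (ExtSelf X) n).range

/-- `Δ` as an object of the category of `A`-modules. -/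
abbrev standardSumCat {A : Type u} [Ring A] {Λ : Type u} [PartialOrder Λ] (e : Λ → A) :
    ModuleCat.{u} A :=
  ModuleCat.of A (StandardSum e)

open Classical in
/-- The idempotent endomorphism `Δ → Δ_l → Δ` of `Δ`. -/
noncomputable def standardProj {A : Type u} [Ring A] {Λ : Type u} [PartialOrder Λ] (e : Λ → A)
    (l : Λ) : StandardSum e →ₗ[A] StandardSum e :=
  LinearMap.single A (Standard e) l ∘ₗ LinearMap.proj l

/-- The idempotent `1_l` in `Γ_0 = End_A(Δ)` of the extension algebra `Γ = Ext_A^*(Δ, Δ)`, so that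
`Γ 1_l = Ext_A^*(Δ_l, Δ)`. -/
noncomputable def extIdem {A : Type u} [Ring A] {Λ : Type u} [PartialOrder Λ] (e : Λ → A) (l : Λ) :
    ExtAlgebra (standardSumCat e) :=
  DirectSum.of (ExtSelf (standardSumCat e)) 0 (Abelian.Ext.mk₀ (ModuleCat.ofHom (standardProj e l)))

/-! ### Idempotents, traces and the canonical map from a ring onto its standard modules -/

section Idempotents

variable {R : Type u} [Ring R] {Λ : Type w} {e : Λ → R}

/-! The corners of `Γ` are `1_m Γ 1_l = Ext^*(Δ_l, Δ_m)`. Dimension shifting along the filtered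
kernels of `P_l → Δ_l` shows that such a corner vanishes unless `l ≤ m`, and that the diagonal
corners are just `End(Δ_l) = k` in degree `0`. So for `m ≠ l` the trace submodule of `Γ 1_l` absorbs
the whole corner `1_m Γ 1_l`, and only the diagonal corner survives: the sum of the standard
`Γ`-modules is `Γ` modulo all off-diagonal corners. It is a quotient of `Γ_0`, and the kernel of `π
: Γ_0 → ⨁ Δ_l` consists of the maps `Δ_l → Δ_m` with `l ≠ m`.

(1) If these maps vanish, `π` is a graded isomorphism. Conversely, off-diagonal elements annihilate
the standard modules; if `Γ_0` embeds there, they annihilate the class of `1` in `Γ_0`, so their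
degree zero part is zero.

(2) Lift `ε : P^0 → ⨁ Δ_l` through `π` to `g : P^0 → Γ_0`. As `Γ_{≥1}` kills `Γ_0` and `P^0` is
generated in degree `0`, `g` kills degree `1` of `P^0`, hence also `ker ε`, which is generated
there. So `g` descends to a section of `π`, and a section forces the off-diagonal maps to vanish
(`exists_section`, `map_eq_zero_of_section`).

For the last claim, `End(Δ)` is now a product of copies of `k`. Comparing the `1_l`-parts of `Hom(A,
Δ) = Δ` and `End(Δ)` gives `dim Δ_l = 1`. Then `Δ` is semisimple, and the kernel of `A → Δ` acts
nilpotently on the `Δ`-filtered module `A`, so this kernel is the radical. -/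

theorem mem_projModule_iff {l : Λ} (he : IsIdempotentElem (e l)) {x : R} :
    x ∈ projModule e l ↔ x * e l = x := by
  refine ⟨fun h => ?_, fun h => Submodule.mem_span_singleton.2 ⟨x, h⟩⟩
  obtain ⟨a, rfl⟩ := Submodule.mem_span_singleton.1 h
  rw [smul_eq_mul, mul_assoc, he.eq]

/-- Right multiplication by `e l`, as a map `R → R e_l`. -/
def toProjModule (e : Λ → R) (l : Λ) : R →ₗ[R] projModule e l :=
  (LinearMap.toSpanSingleton R R (e l)).codRestrict _ fun x =>
    Submodule.mem_span_singleton.2 ⟨x, rfl⟩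

@[simp] theorem coe_toProjModule (l : Λ) (x : R) : (toProjModule e l x : R) = x * e l := rfl

theorem toProjModule_coe {l : Λ} (he : IsIdempotentElem (e l)) (y : projModule e l) :
    toProjModule e l y = y :=
  Subtype.ext ((mem_projModule_iff he).1 y.2)

variable [PartialOrder Λ]

/-- Such a `y` is the image of `e m` under right multiplication by `y`, a map `R e_m → R e_l`. -/
theorem mem_traceKernel_of_mul_eq {l m : Λ} (hml : ¬ m ≤ l) {y : projModule e l}
    (hy : e m * (y : R) = y) : y ∈ traceKernel e l := by
  let f : projModule e m →ₗ[R] projModule e l :=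
    (LinearMap.toSpanSingleton R (projModule e l) y) ∘ₗ (projModule e m).subtype
  have hf : f ⟨e m, Submodule.mem_span_singleton_self _⟩ = y := Subtype.ext hy
  refine Submodule.mem_iSup_of_mem m (Submodule.mem_iSup_of_mem hml
    (Submodule.mem_iSup_of_mem f ⟨_, hf⟩))

/-- If `e_l R e_m = 0`, then `e_l R` annihilates `R e_m` and hence all its homomorphic images. -/
theorem mul_eq_zero_of_mem_traceKernel (he : ∀ l, IsIdempotentElem (e l)) {l : Λ}
    (h : ∀ m, ¬ m ≤ l → ∀ x, e l * x * e m = 0) {y : projModule e l} (hy : y ∈ traceKernel e l) :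
    e l * (y : R) = 0 := by
  -- The factor `x` is built into the condition so that it is stable under left multiplication.
  let N : Submodule R (projModule e l) :=
    { carrier := {y | ∀ x, e l * x * (y : R) = 0}
      add_mem' := fun {a b} ha hb x => by
        rw [Submodule.coe_add, mul_add, ha x, hb x, add_zero]
      zero_mem' := fun x => by simp
      smul_mem' := fun c y hy x => by
        rw [Submodule.coe_smul, smul_eq_mul, ← mul_assoc, mul_assoc (e l)]; exact hy _ }
  have key : traceKernel e l ≤ N := by
    refine iSup_le fun m => iSup_le fun hml => iSup_le fun f => ?_
    rintro _ ⟨y, rfl⟩ x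
    have hy : (e l * x) • y = 0 := by
      refine Subtype.ext ?_
      rw [Submodule.coe_smul, smul_eq_mul, ← (mem_projModule_iff (he m)).1 y.2, ← mul_assoc,
        mul_assoc (e l), h m hml, Submodule.coe_zero]
    rw [← smul_eq_mul, ← Submodule.coe_smul, ← map_smul, hy, map_zero, Submodule.coe_zero]
  simpa using key hy 1

/-- The map `R → ⨁_l Δ_l` sending `1` to the sum of the canonical generators. -/
def toStandardSum (e : Λ → R) : R →ₗ[R] StandardSum e :=
  LinearMap.pi fun l => (traceKernel e l).mkQ ∘ₗ toProjModule e l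

theorem toStandardSum_apply (x : R) (l : Λ) :
    toStandardSum e x l = (traceKernel e l).mkQ (toProjModule e l x) := rfl

theorem toStandardSum_apply_eq_zero {x : R} {l : Λ} (hx : x * e l = 0) :
    toStandardSum e x l = 0 := by
  rw [toStandardSum_apply, show toProjModule e l x = 0 from Subtype.ext hx, map_zero]

theorem toStandardSum_surjective [Fintype Λ] (he : OrthogonalIdempotents e) :
    Function.Surjective (toStandardSum e) := by
  intro z
  choose y hy using fun l => (traceKernel e l).mkQ_surjective (z l)
  refine ⟨∑ l, (y l : R), funext fun l => ?_⟩
  rw [toStandardSum_apply, ← hy l]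
  congr 1
  refine Subtype.ext ?_
  rw [coe_toProjModule, Finset.sum_mul, Finset.sum_eq_single l]
  · exact (mem_projModule_iff (he.idem l)).1 (y l).2
  · intro m _ hml
    rw [← (mem_projModule_iff (he.idem m)).1 (y m).2, mul_assoc, he.ortho hml, mul_zero]
  · simp

/-- Homogeneous lifts of the components, chosen in the various `R e_l`, add up to a single
homogeneous element of `R`. -/
theorem mem_standardSumDeg_iff [Fintype Λ] (he : OrthogonalIdempotents e) {𝒜 : ℕ → AddSubgroup R}
    (h𝒜 : ∀ n x l, x ∈ 𝒜 n → x * e l ∈ 𝒜 n) {n : ℕ} {z : StandardSum e} :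
    z ∈ standardSumDeg 𝒜 e n ↔ ∃ x ∈ 𝒜 n, toStandardSum e x = z := by
  constructor
  · intro hz
    choose y hy hyz using fun l => hz l (Set.mem_univ l)
    refine ⟨∑ l, (y l : R), sum_mem fun l _ => hy l, funext fun l => ?_⟩
    rw [toStandardSum_apply, ← hyz l]
    change _ = (traceKernel e l).mkQ (y l)
    congr 1
    refine Subtype.ext ?_
    rw [coe_toProjModule, Finset.sum_mul, Finset.sum_eq_single l]
    · exact (mem_projModule_iff (he.idem l)).1 (y l).2
    · intro m _ hml
      rw [← (mem_projModule_iff (he.idem m)).1 (y m).2, mul_assoc, he.ortho hml, mul_zero]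
    · simp
  · rintro ⟨x, hx, rfl⟩ l -
    exact ⟨toProjModule e l x, h𝒜 n x l hx, rfl⟩

end Idempotents

/-! ### Directed graded rings and the comparison of `R_0` with the standard modules -/

/-- A ring `R` with subgroups `𝒜 n` spanning it, a complete family of orthogonal idempotents `e l`
of degree `0`, and a ring homomorphism `p` with kernel `R_{≥ 1}`, such that the quiver of `R` is
directed with respect to the partial order on `Λ` and the rings `e l * R * e l` are division rings
in degree `0`. -/
structure IsDirectedGrading {R : Type u} [Ring R] {Λ : Type w} [PartialOrder Λ] [Fintype Λ]
    (𝒜 : ℕ → AddSubgroup R) (e : Λ → R) {S : Type v} [Ring S] (p : R →+* S) : Prop where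
  idem : CompleteOrthogonalIdempotents e
  map_eq_zero_iff : ∀ x, p x = 0 ↔ x ∈ positivePart 𝒜
  mem_iSup : ∀ x, x ∈ ⨆ n, 𝒜 n
  mul_mem : ∀ n x l, x ∈ 𝒜 n → x * e l ∈ 𝒜 n
  directed : ∀ l m, ¬ l ≤ m → ∀ x, e m * x * e l = 0
  diag : ∀ l x, p x = 0 → e l * x * e l = 0
  division : ∀ l x, e l * x * e l ≠ 0 → ∃ y, p (e l * x * e l) * y = p (e l)
  ne_zero : ∀ l, e l ≠ 0

namespace IsDirectedGrading

variable {R : Type u} [Ring R] {Λ : Type w} [PartialOrder Λ] [Fintype Λ]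
  {𝒜 : ℕ → AddSubgroup R} {e : Λ → R} {S : Type v} [Ring S] {p : R →+* S}

theorem map_eq_zero_of_mem (h : IsDirectedGrading 𝒜 e p) {n : ℕ} (hn : 1 ≤ n) {x : R}
    (hx : x ∈ 𝒜 n) : p x = 0 :=
  (h.map_eq_zero_iff x).2 (Submodule.subset_span ⟨n, hn, hx⟩)

/-- Off-diagonal elements annihilate the standard modules. -/
theorem smul_standardSum_eq_zero (h : IsDirectedGrading 𝒜 e p) {l m : Λ} (hlm : l ≠ m) (x : R)
    (z : StandardSum e) : (e m * x * e l) • z = 0 := by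
  obtain ⟨r, rfl⟩ := toStandardSum_surjective h.idem.toOrthogonalIdempotents z
  rw [← map_smul]
  funext n
  rw [toStandardSum_apply]
  refine (Submodule.Quotient.mk_eq_zero _).2 ?_
  by_cases hmn : m ≤ n
  · have h0 : e m * x * e l * r * e n = 0 := by
      -- A nonzero product needs `n ≤ l ≤ m`; with `m ≤ n` this would force `l = m`.
      by_cases hnl : n ≤ l
      · rw [h.directed l m fun hl => hlm (le_antisymm hl (hmn.trans hnl)), zero_mul, zero_mul]
      · rw [mul_assoc, mul_assoc, ← mul_assoc (e l), h.directed n l hnl, mul_zero]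
    convert Submodule.zero_mem _
    exact Subtype.ext h0
  · refine mem_traceKernel_of_mul_eq hmn ?_
    simp only [coe_toProjModule, smul_eq_mul, ← mul_assoc, (h.idem.idem m).eq]

/-- In the `n`-th component, a corner `e_m x e_n` with `m ≰ n` lies in the trace, one with `m < n`
vanishes by directedness, and the diagonal one vanishes because it has no part of positive degree.
-/
theorem toStandardSum_eq_zero (h : IsDirectedGrading 𝒜 e p) {x : R} (hx : p x = 0) :
    toStandardSum e x = 0 := by
  funext n
  rw [toStandardSum_apply]
  refine (Submodule.Quotient.mk_eq_zero _).2 ?_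
  have hsum : x = ∑ m, e m * x := by rw [← Finset.sum_mul, h.idem.complete, one_mul]
  rw [hsum, map_sum]
  refine sum_mem fun m _ => ?_
  by_cases hmn : m ≤ n
  · have h0 : e m * x * e n = 0 := by
      by_cases hnm : n ≤ m
      · obtain rfl := le_antisymm hmn hnm
        exact h.diag m x hx
      · exact h.directed n m hnm x
    convert Submodule.zero_mem _
    exact Subtype.ext h0
  · refine mem_traceKernel_of_mul_eq hmn ?_
    simp only [coe_toProjModule, ← mul_assoc, (h.idem.idem m).eq]

theorem mul_mul_eq_zero (h : IsDirectedGrading 𝒜 e p) {x : R} {l : Λ}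
    (hx : toStandardSum e x l = 0) : e l * x * e l = 0 := by
  rw [mul_assoc]
  exact mul_eq_zero_of_mem_traceKernel h.idem.idem (fun m hml x => h.directed m l hml x)
    ((Submodule.Quotient.mk_eq_zero _).1 hx)

theorem map_eq_sum (h : IsDirectedGrading 𝒜 e p)
    (hoff : ∀ l m, l ≠ m → ∀ x, p (e m * x * e l) = 0) (x : R) :
    p x = ∑ l, p (e l * x * e l) := by
  have hsum : x = ∑ l, ∑ m, e m * x * e l := by
    simp_rw [← Finset.sum_mul, h.idem.complete, one_mul, ← Finset.mul_sum, h.idem.complete, mul_one]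
  conv_lhs => rw [hsum]
  rw [map_sum]
  refine Finset.sum_congr rfl fun l _ => ?_
  rw [map_sum, Finset.sum_eq_single l (fun m _ hml => hoff l m hml.symm x) (by simp)]

/-- Once `R_0` is diagonal, `p x` is determined by the corners `e_l x e_l`, and these can be read
off from the image of `x` in the standard modules. -/
theorem ker_toStandardSum (h : IsDirectedGrading 𝒜 e p)
    (hoff : ∀ l m, l ≠ m → ∀ x, p (e m * x * e l) = 0) :
    LinearMap.ker (toStandardSum e) = positivePart 𝒜 := by
  ext x
  rw [LinearMap.mem_ker, ← h.map_eq_zero_iff]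
  refine ⟨fun hx => ?_, h.toStandardSum_eq_zero⟩
  rw [h.map_eq_sum hoff]
  exact Finset.sum_eq_zero fun l _ => by rw [h.mul_mul_eq_zero (congrFun hx l), map_zero]

theorem gradedIso (h : IsDirectedGrading 𝒜 e p)
    (hoff : ∀ l m, l ≠ m → ∀ x, p (e m * x * e l) = 0) :
    GradedIso R (degreeZeroDeg 𝒜) (standardSumDeg 𝒜 e) := by
  let φ : DegreeZeroModule 𝒜 ≃ₗ[R] StandardSum e :=
    (Submodule.quotEquivOfEq _ _ (h.ker_toStandardSum hoff).symm).trans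
      ((toStandardSum e).quotKerEquivOfSurjective
        (toStandardSum_surjective h.idem.toOrthogonalIdempotents))
  have hφ : ∀ x, φ ((positivePart 𝒜).mkQ x) = toStandardSum e x := fun x => rfl
  refine ⟨φ, fun n z => ?_⟩
  rw [mem_standardSumDeg_iff h.idem.toOrthogonalIdempotents h.mul_mem]
  constructor
  · rintro ⟨x, hx, rfl⟩
    exact ⟨x, hx, rfl⟩
  · rintro ⟨x, hx, hxz⟩
    exact ⟨x, hx, φ.injective hxz⟩

/-- If the degree zero part embeds into the sum of the standard modules, then it is diagonal. -/
theorem map_eq_zero_of_injective (h : IsDirectedGrading 𝒜 e p)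
    {φ : DegreeZeroModule 𝒜 →ₗ[R] StandardSum e} (hφ : Function.Injective φ) {l m : Λ}
    (hlm : l ≠ m) (x : R) : p (e m * x * e l) = 0 := by
  have h1 : (e m * x * e l) • (positivePart 𝒜).mkQ 1 = 0 :=
    hφ (by rw [map_smul, map_zero, h.smul_standardSum_eq_zero hlm])
  rw [← map_smul, smul_eq_mul, mul_one] at h1
  exact (h.map_eq_zero_iff _).2 ((Submodule.Quotient.mk_eq_zero _).1 h1)

/-- The canonical epimorphism from the degree zero part to the sum of the standard modules. -/
def toStandardSumQuot (h : IsDirectedGrading 𝒜 e p) : DegreeZeroModule 𝒜 →ₗ[R] StandardSum e :=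
  (positivePart 𝒜).liftQ (toStandardSum e) fun x hx =>
    h.toStandardSum_eq_zero ((h.map_eq_zero_iff x).2 hx)

theorem toStandardSumQuot_mkQ (h : IsDirectedGrading 𝒜 e p) (x : R) :
    h.toStandardSumQuot ((positivePart 𝒜).mkQ x) = toStandardSum e x := rfl

theorem toStandardSumQuot_surjective (h : IsDirectedGrading 𝒜 e p) :
    Function.Surjective h.toStandardSumQuot := fun z => by
  obtain ⟨x, rfl⟩ := toStandardSum_surjective h.idem.toOrthogonalIdempotents z
  exact ⟨_, h.toStandardSumQuot_mkQ x⟩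

/-- If the epimorphism to the sum of the standard modules splits, then the degree zero part is
diagonal. -/
theorem map_eq_zero_of_section (h : IsDirectedGrading 𝒜 e p)
    {σ : StandardSum e →ₗ[R] DegreeZeroModule 𝒜} (hσ : h.toStandardSumQuot ∘ₗ σ = LinearMap.id)
    {l m : Λ} (hlm : l ≠ m) (x : R) : p (e m * x * e l) = 0 := by
  set g : StandardSum e := toStandardSum e (e l) with hg
  obtain ⟨r, hr⟩ := (positivePart 𝒜).mkQ_surjective (σ g)
  have h1 : toStandardSum e r = g := by
    rw [← h.toStandardSumQuot_mkQ, hr]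
    exact LinearMap.congr_fun hσ g
  have h2 : (e m * x * e l) • (positivePart 𝒜).mkQ r = 0 := by
    rw [hr, ← map_smul, h.smul_standardSum_eq_zero hlm, map_zero]
  rw [← map_smul] at h2
  have h3 : p (e m * x * e l * r) = 0 :=
    (h.map_eq_zero_iff _).2 ((Submodule.Quotient.mk_eq_zero _).1 h2)
  -- The element `e_l r e_l` still maps to the generator `g` of `Δ_l`, which is nonzero because the
  -- trace submodule does not contain `e_l`.
  have h4 : e l * r * e l ≠ 0 := by
    intro h0
    have h5 : toStandardSum e (e l * r * e l) = g := by
      rw [mul_assoc, ← smul_eq_mul, map_smul]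
      have h6 : toStandardSum e (r * e l) = g := by
        have h7 : toStandardSum e (r - r * e l) l = 0 :=
          toStandardSum_apply_eq_zero (by rw [sub_mul, mul_assoc, (h.idem.idem l).eq, sub_self])
        rw [map_sub, h1, Pi.sub_apply, sub_eq_zero] at h7
        funext n
        by_cases hn : n = l
        · subst hn; exact h7.symm
        · have h8 : ∀ y, toStandardSum e (y * e l) n = 0 := fun y =>
            toStandardSum_apply_eq_zero (by rw [mul_assoc, h.idem.ortho (Ne.symm hn), mul_zero])
          rw [h8, hg, ← one_mul (e l), h8]
      rw [h6, hg, ← map_smul, smul_eq_mul, (h.idem.idem l).eq]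
    rw [h0, map_zero] at h5
    refine h.ne_zero l ?_
    have := h.mul_mul_eq_zero (x := e l) (congrFun h5.symm l)
    rwa [(h.idem.idem l).eq, (h.idem.idem l).eq] at this
  -- The diagonal corner of `r` is right invertible after `p`, so it can be cancelled from `p (e_m x
  -- e_l r) = 0`.
  obtain ⟨y, hy⟩ := h.division l r h4
  calc p (e m * x * e l) = p (e m * x * e l) * p (e l) := by
        rw [← map_mul, mul_assoc _ (e l), (h.idem.idem l).eq]
    _ = p (e m * x * e l) * p (e l * r * e l) * y := by rw [mul_assoc (p _) (p _) y, hy]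
    _ = p (e m * x * e l * r) * p (e l) * y := by
        rw [← map_mul, ← map_mul, ← mul_assoc, ← mul_assoc, mul_assoc _ (e l) (e l),
          (h.idem.idem l).eq]
    _ = 0 := by rw [h3, zero_mul, zero_mul]

/-- A lift of `ε` through `π` vanishes on `ker ε` for degree reasons. The lift need not be
homogeneous: it matters only that its target is killed by `R_{≥ 1}`. -/
theorem exists_section (h : IsDirectedGrading 𝒜 e p) {M : Type u} [AddCommGroup M]
    [Module R M] {ℳ : ℕ → AddSubgroup M} (L : LinearProjectiveResolution 𝒜 M ℳ)
    {π : DegreeZeroModule 𝒜 →ₗ[R] M} (hπ : Function.Surjective π) :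
    ∃ σ : M →ₗ[R] DegreeZeroModule 𝒜, π ∘ₗ σ = LinearMap.id := by
  have := L.projective 0
  obtain ⟨g, hg⟩ := Module.projective_lifting_property π L.ε hπ
  have hpos : ∀ i, 1 ≤ i → ∀ a ∈ 𝒜 i, ∀ z : L.P 0, g (a • z) = 0 := fun i hi a ha z => by
    rw [map_smul]
    obtain ⟨r, hr⟩ := (positivePart 𝒜).mkQ_surjective (g z)
    rw [← hr, ← map_smul]
    refine (Submodule.Quotient.mk_eq_zero _).2 ((h.map_eq_zero_iff _).1 ?_)
    rw [smul_eq_mul, map_mul, h.map_eq_zero_of_mem hi ha, zero_mul]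
  have hdeg : ∀ z ∈ L.deg 0 1, g z = 0 := by
    classical
    let _ := (L.grading 0).internal.chooseDecomposition
    -- Projection onto degree `1`. On `a • q` with `q` of degree `0` it selects the part of `a` in
    -- degree `1`, which `g` kills.
    let c : L.P 0 →+ L.P 0 := (L.deg 0 1).subtype.comp
      ((DFinsupp.evalAddMonoidHom 1).comp (DirectSum.decomposeAddEquiv (L.deg 0)).toAddMonoidHom)
    have hc : ∀ n, ∀ z ∈ L.deg 0 n, c z = if n = 1 then z else 0 := fun n z hz => by
      change ((DirectSum.decompose (L.deg 0) z 1 : L.deg 0 1) : L.P 0) = _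
      split_ifs with hn
      · subst hn; exact DirectSum.decompose_of_mem_same _ hz
      · exact DirectSum.decompose_of_mem_ne _ hz hn
    have hall : ∀ z : L.P 0, g (c z) = 0 := by
      intro z
      have hz : z ∈ Submodule.span R (L.deg 0 0 : Set (L.P 0)) := by
        rw [L.generated 0]; trivial
      rw [Submodule.mem_span_iff_exists_finset_subset] at hz
      obtain ⟨f, t, ht, -, rfl⟩ := hz
      rw [map_sum, map_sum]
      refine Finset.sum_eq_zero fun q hq => ?_
      have hq0 : q ∈ L.deg 0 0 := ht hq
      refine AddSubgroup.iSup_induction 𝒜 (C := fun a => g (c (a • q)) = 0) (h.mem_iSup (f q))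
        (fun i a ha => ?_) (by simp) fun a b ha hb => by
          rw [add_smul, map_add, map_add, ha, hb, add_zero]
      · have := (L.grading 0).smul_mem i 0 a q ha hq0
        rw [add_zero] at this
        rw [hc i _ this]
        split_ifs with hi
        · exact hpos i hi.ge a ha q
        · exact map_zero g
    intro z hz
    have := hall z
    rwa [hc 1 z hz, if_pos rfl] at this
  have hker : LinearMap.ker L.ε ≤ LinearMap.ker g := by
    intro z hz
    obtain ⟨w, rfl⟩ := (L.exact_zero z).1 hz
    have hw : w ∈ Submodule.span R (L.deg 1 1 : Set (L.P 1)) := by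
      rw [L.generated 1]; trivial
    have hle : Submodule.span R (L.deg 1 1 : Set (L.P 1)) ≤ LinearMap.ker (g ∘ₗ L.d 0) :=
      Submodule.span_le.2 fun w hw => hdeg _ (L.d_mem 0 1 w hw)
    exact hle hw
  let σ := (LinearMap.ker L.ε).liftQ g hker ∘ₗ
    (L.ε.quotKerEquivOfSurjective L.ε_surjective).symm.toLinearMap
  refine ⟨σ, LinearMap.ext fun z => ?_⟩
  obtain ⟨q, rfl⟩ := L.ε_surjective z
  have hσ : σ (L.ε q) = g q := by
    have : (L.ε.quotKerEquivOfSurjective L.ε_surjective).symm (L.ε q) =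
        Submodule.Quotient.mk q := by
      rw [LinearEquiv.symm_apply_eq]; rfl
    simp only [σ, LinearMap.comp_apply, LinearEquiv.coe_coe, this]
    rfl
  rw [LinearMap.comp_apply, hσ]
  exact LinearMap.congr_fun hg q

/-- If the sum of the standard modules is linear, then the degree zero part is diagonal. -/
theorem map_eq_zero_of_linearProjectiveResolution {Λ : Type u} [PartialOrder Λ] [Fintype Λ]
    {e : Λ → R} (h : IsDirectedGrading 𝒜 e p) {ℳ : ℕ → AddSubgroup (StandardSum e)}
    (L : LinearProjectiveResolution 𝒜 (StandardSum e) ℳ) {l m : Λ} (hlm : l ≠ m) (x : R) :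
    p (e m * x * e l) = 0 := by
  obtain ⟨σ, hσ⟩ := h.exists_section L h.toStandardSumQuot_surjective
  exact h.map_eq_zero_of_section hσ hlm x

end IsDirectedGrading

/-! ### Vanishing of extensions between standard modules -/

section ExtVanishing

open Abelian

variable {A : Type u} [Ring A]

theorem subsingleton_ext_of_linearEquiv {M N : Type u} [AddCommGroup M] [Module A M]
    [AddCommGroup N] [Module A N] (φ : M ≃ₗ[A] N) (Y : ModuleCat.{u} A) (n : ℕ)
    [Subsingleton (Ext.{u} (ModuleCat.of A N) Y n)] :
    Subsingleton (Ext.{u} (ModuleCat.of A M) Y n) := by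
  refine subsingleton_of_forall_eq 0 fun x => ?_
  have h : ModuleCat.ofHom φ.toLinearMap ≫ ModuleCat.ofHom φ.symm.toLinearMap =
      𝟙 (ModuleCat.of A M) := by
    ext; simp
  rw [← Ext.mk₀_id_comp x, ← h, ← Ext.mk₀_comp_mk₀_assoc,
    Subsingleton.elim ((Ext.mk₀ (ModuleCat.ofHom φ.symm.toLinearMap)).comp x _) 0, Ext.comp_zero]

theorem subsingleton_ext_of_ker {M N : Type u} [AddCommGroup M] [Module A M]
    [AddCommGroup N] [Module A N] {f : M →ₗ[A] N} (hf : Function.Surjective f)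
    (Y : ModuleCat.{u} A) (n : ℕ)
    [Subsingleton (Ext.{u} (ModuleCat.of A (LinearMap.ker f)) Y n)]
    [Subsingleton (Ext.{u} (ModuleCat.of A N) Y n)] :
    Subsingleton (Ext.{u} (ModuleCat.of A M) Y n) := by
  refine subsingleton_of_forall_eq 0 fun x => ?_
  obtain ⟨y, rfl⟩ := Ext.contravariant_sequence_exact₂ (LinearMap.shortExact_shortComplexKer hf) Y x
    (Subsingleton.elim (α := Ext.{u} (ModuleCat.of A (LinearMap.ker f)) Y n) _ _)
  rw [Subsingleton.elim (α := Ext.{u} (ModuleCat.of A N) Y n) y 0, Ext.comp_zero]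

/-- Dimension shift: the connecting map from `Ext^n` of the kernel is onto, as `Ext^(n+1)` vanishes
on the projective `M`. -/
theorem subsingleton_ext_succ_of_ker {M N : Type u} [AddCommGroup M] [Module A M]
    [Module.Projective A M] [AddCommGroup N] [Module A N] {f : M →ₗ[A] N}
    (hf : Function.Surjective f) (Y : ModuleCat.{u} A) (n : ℕ)
    [Subsingleton (Ext.{u} (ModuleCat.of A (LinearMap.ker f)) Y n)] :
    Subsingleton (Ext.{u} (ModuleCat.of A N) Y (n + 1)) := by
  refine subsingleton_of_forall_eq 0 fun x => ?_
  have : Projective (ModuleCat.of A M) := (IsProjective.iff_projective M).1 inferInstance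
  obtain ⟨y, rfl⟩ := Ext.contravariant_sequence_exact₃ (LinearMap.shortExact_shortComplexKer hf) Y x
    (Ext.eq_zero_of_projective (P := ModuleCat.of A M) _) (add_comm 1 n)
  rw [Subsingleton.elim (α := Ext.{u} (ModuleCat.of A (LinearMap.ker f)) Y n) y 0, Ext.comp_zero]

theorem DeltaFiltration.subsingleton_ext {Λ : Type w} {Δ : Λ → Type u}
    [∀ l, AddCommGroup (Δ l)] [∀ l, Module A (Δ l)] {M : Type u} [AddCommGroup M] [Module A M]
    (F : DeltaFiltration (A := A) Δ M) (Y : ModuleCat.{u} A) (n : ℕ)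
    (h : ∀ j, Subsingleton (Ext.{u} (ModuleCat.of A (Δ (F.label j))) Y n)) :
    Subsingleton (Ext.{u} (ModuleCat.of A M) Y n) := by
  have key : ∀ j ≤ F.length, Subsingleton (Ext.{u} (ModuleCat.of A (F.sub j)) Y n) := by
    intro j
    induction j with
    | zero =>
      intro _
      refine subsingleton_of_forall_eq 0 fun x => ?_
      have h0 : 𝟙 (ModuleCat.of A (F.sub 0)) = 0 := by
        ext x
        exact (Submodule.mem_bot A).1 (F.sub_zero ▸ x.2)
      rw [← Ext.mk₀_id_comp x, h0, Ext.mk₀_zero, Ext.zero_comp]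
    | succ j ih =>
      intro hj
      have := ih (by omega)
      obtain ⟨φ⟩ := F.factor ⟨j, hj⟩
      let N := (F.sub j).submoduleOf (F.sub (j + 1))
      have : Subsingleton (Ext.{u} (ModuleCat.of A (F.sub (j + 1) ⧸ N)) Y n) := by
        have := h ⟨j, hj⟩
        exact subsingleton_ext_of_linearEquiv φ Y n
      have : Subsingleton (Ext.{u} (ModuleCat.of A (LinearMap.ker N.mkQ)) Y n) :=
        subsingleton_ext_of_linearEquiv ((LinearEquiv.ofEq _ _ N.ker_mkQ).trans
          (Submodule.submoduleOfEquivOfLe (F.mono j.le_succ))) Y n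
      exact subsingleton_ext_of_ker N.mkQ_surjective Y n
  have := key F.length le_rfl
  exact subsingleton_ext_of_linearEquiv
    (Submodule.topEquiv.symm.trans (LinearEquiv.ofEq _ _ F.sub_length.symm)) Y n

theorem projective_projModule {Λ : Type w} {e : Λ → A} {l : Λ} (he : IsIdempotentElem (e l)) :
    Module.Projective A (projModule e l) :=
  .of_split (projModule e l).subtype (toProjModule e l) (LinearMap.ext (toProjModule_coe he))

variable {Λ : Type w} [PartialOrder Λ] {e : Λ → A}

theorem IsStandardlyStratified.hom_eq_zero (h : IsStandardlyStratified e) {l m : Λ}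
    (hlm : ¬ l ≤ m) (f : Standard e l →ₗ[A] Standard e m) : f = 0 := by
  refine LinearMap.ext fun x => ?_
  obtain ⟨y, rfl⟩ := (traceKernel e l).mkQ_surjective x
  exact LinearMap.congr_fun (h.multiplicity_zero m l hlm (f ∘ₗ (traceKernel e l).mkQ)) y

/-- Each dimension shift replaces `Δ_l` by factors `Δ_j` with `j > l`. Since `j ≤ m` would give `l <
m`, both hypotheses persist down to degree `0`, where `Hom(Δ_j, Δ_m) = 0`. -/
theorem IsStandardlyStratified.subsingleton_ext (h : IsStandardlyStratified e)
    (he : ∀ l, IsIdempotentElem (e l)) {n : ℕ} {l m : Λ} (h0 : n = 0 → ¬ l ≤ m) (hlm : ¬ l < m) :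
    Subsingleton (Ext.{u} (ModuleCat.of A (Standard e l)) (ModuleCat.of A (Standard e m)) n) := by
  induction n generalizing l with
  | zero =>
    refine subsingleton_of_forall_eq 0 fun x => ?_
    obtain ⟨f, rfl⟩ := Ext.mk₀_bijective _ _ |>.2 x
    rw [show f = 0 from ModuleCat.hom_ext (h.hom_eq_zero (h0 rfl) f.hom), Ext.mk₀_zero]
  | succ n ih =>
    have := projective_projModule (he l)
    obtain ⟨F, hF⟩ := h.kernel_filtered l
    have := F.subsingleton_ext (ModuleCat.of A (Standard e m)) n fun j =>
      ih (fun _ hj => hlm ((hF j).trans_le hj)) (fun hj => hlm ((hF j).trans hj))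
    have : Subsingleton (Ext.{u} (ModuleCat.of A (LinearMap.ker (traceKernel e l).mkQ))
        (ModuleCat.of A (Standard e m)) n) :=
      subsingleton_ext_of_linearEquiv (LinearEquiv.ofEq _ _ (traceKernel e l).ker_mkQ) _ n
    exact subsingleton_ext_succ_of_ker (traceKernel e l).mkQ_surjective _ n

end ExtVanishing

/-! ### The extension algebra and its degree zero part -/

section ExtAlgebra

open Abelian

variable {A : Type u} [Ring A] (X : ModuleCat.{u} A)

/-- The projections `Ext^0(X, X) ≃ End(X)` and `Ext^(n+1)(X, X) → 0`. -/
noncomputable def extToEnd : ∀ n, ExtSelf X n →+ Module.End A X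
  | 0 => (ModuleCat.homAddEquiv (M := X) (N := X)).toAddMonoidHom.comp
      (Ext.addEquiv₀ (X := X) (Y := X)).toAddMonoidHom
  | _ + 1 => 0

theorem extToEnd_mk₀ (f : X ⟶ X) : extToEnd X 0 (Ext.mk₀ f) = f.hom := by
  have : Ext.addEquiv₀ (Ext.mk₀ f) = f := Ext.addEquiv₀.apply_symm_apply f
  change (Ext.addEquiv₀ (Ext.mk₀ f)).hom = f.hom
  rw [this]

/-- The projection of the extension algebra of `X` onto its degree zero part `End(X)`. -/
noncomputable def extAlgebraToEnd : ExtAlgebra X →+* Module.End A X :=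
  DirectSum.toSemiring (extToEnd X)
    ((extToEnd_mk₀ X (𝟙 X)).trans rfl) fun {i j} x y => by
      cases i with
      | zero =>
        cases j with
        | zero =>
          obtain ⟨f, rfl⟩ := Ext.mk₀_bijective _ _ |>.2 x
          obtain ⟨g, rfl⟩ := Ext.mk₀_bijective _ _ |>.2 y
          rw [extToEnd_mk₀, extToEnd_mk₀]
          exact (congrArg (extToEnd X 0) (Ext.mk₀_comp_mk₀ g f)).trans (extToEnd_mk₀ X (g ≫ f))
        | succ j => exact (mul_zero (extToEnd X 0 x)).symm
      | succ i =>
        cases j with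
        | zero => exact (zero_mul (extToEnd X 0 y)).symm
        | succ j => exact (zero_mul (0 : Module.End A X)).symm

theorem extAlgebraToEnd_of (n : ℕ) (x : ExtSelf X n) :
    extAlgebraToEnd X (DirectSum.of (ExtSelf X) n x) = extToEnd X n x :=
  DirectSum.toSemiring_of _ _ _ _ _

variable {X}

theorem of_mk₀_mul_of (f : X ⟶ X) {n : ℕ} (x : ExtSelf X n) :
    DirectSum.of (ExtSelf X) 0 (Ext.mk₀ f) * DirectSum.of (ExtSelf X) n x =
      DirectSum.of (ExtSelf X) n (x.comp (Ext.mk₀ f) (add_zero n)) := by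
  rw [DirectSum.of_mul_of]
  exact DirectSum.of_eq_of_gradedMonoid_eq (ext_comp_mk x (Ext.mk₀ f) _ (add_zero n))

theorem of_mul_of_mk₀ (f : X ⟶ X) {n : ℕ} (x : ExtSelf X n) :
    DirectSum.of (ExtSelf X) n x * DirectSum.of (ExtSelf X) 0 (Ext.mk₀ f) =
      DirectSum.of (ExtSelf X) n ((Ext.mk₀ f).comp x (zero_add n)) := by
  rw [DirectSum.of_mul_of]
  exact DirectSum.of_eq_of_gradedMonoid_eq (ext_comp_mk (Ext.mk₀ f) x _ (zero_add n))

variable (X)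

/-- The inclusion of `End(X)` into the extension algebra of `X`. -/
noncomputable def endToExtAlgebra : Module.End A X →+* ExtAlgebra X where
  toFun f := DirectSum.of (ExtSelf X) 0 (Ext.mk₀ (ModuleCat.ofHom f))
  map_one' := rfl
  map_mul' f g := by
    rw [of_mk₀_mul_of, Ext.mk₀_comp_mk₀]; rfl
  map_zero' := by
    rw [show ModuleCat.ofHom (0 : Module.End A X) = 0 from rfl, Ext.mk₀_zero, map_zero]
  map_add' f g := by
    rw [show ModuleCat.ofHom (f + g) = ModuleCat.ofHom f + ModuleCat.ofHom g from rfl,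
      Ext.mk₀_add, map_add]

theorem endToExtAlgebra_apply (f : Module.End A X) :
    endToExtAlgebra X f = DirectSum.of (ExtSelf X) 0 (Ext.mk₀ (ModuleCat.ofHom f)) := rfl

@[simp] theorem extAlgebraToEnd_endToExtAlgebra (f : Module.End A X) :
    extAlgebraToEnd X (endToExtAlgebra X f) = f := by
  rw [endToExtAlgebra_apply, extAlgebraToEnd_of, extToEnd_mk₀]; rfl

theorem sub_endToExtAlgebra_mem (x : ExtAlgebra X) :
    x - endToExtAlgebra X (extAlgebraToEnd X x) ∈ positivePart (extDeg X) := by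
  induction x using DirectSum.induction_on with
  | zero => simp
  | of n x =>
    rw [extAlgebraToEnd_of]
    cases n with
    | zero =>
      obtain ⟨f, rfl⟩ := Ext.mk₀_bijective _ _ |>.2 x
      rw [extToEnd_mk₀, endToExtAlgebra_apply, ModuleCat.ofHom_hom, sub_self]
      exact Submodule.zero_mem _
    | succ n =>
      rw [show extToEnd X (n + 1) x = 0 from rfl, map_zero, sub_zero]
      exact Submodule.subset_span ⟨n + 1, by omega, x, rfl⟩
  | add x y hx hy =>
    rw [map_add, map_add, add_sub_add_comm]
    exact Submodule.add_mem _ hx hy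

theorem extAlgebraToEnd_eq_zero_iff (x : ExtAlgebra X) :
    extAlgebraToEnd X x = 0 ↔ x ∈ positivePart (extDeg X) := by
  constructor
  · intro hx
    simpa [hx] using sub_endToExtAlgebra_mem X x
  · have hle : positivePart (extDeg X) ≤ RingHom.ker (extAlgebraToEnd X) := by
      refine Submodule.span_le.2 ?_
      rintro _ ⟨n, hn, y, rfl⟩
      obtain ⟨n, rfl⟩ := Nat.exists_eq_add_of_le' hn
      exact extAlgebraToEnd_of X (n + 1) y
    exact fun hx => hle hx

variable {X}

theorem endToExtAlgebra_mul_of_mul (f g : Module.End A X) {n : ℕ} (x : ExtSelf X n) :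
    endToExtAlgebra X g * DirectSum.of (ExtSelf X) n x * endToExtAlgebra X f =
      DirectSum.of (ExtSelf X) n ((Ext.mk₀ (ModuleCat.ofHom f)).comp
        (x.comp (Ext.mk₀ (ModuleCat.ofHom g)) (add_zero n)) (zero_add n)) := by
  rw [endToExtAlgebra_apply, endToExtAlgebra_apply, of_mk₀_mul_of, of_mul_of_mk₀]

/-- Rebracketed, the product has the class of `x` restricted along `ι` and pushed out along `π'` as
a factor, and this lies in `Ext^n(Y, Z) = 0`. -/
theorem endToExtAlgebra_mul_of_mul_eq_zero {Y Z : Type u} [AddCommGroup Y] [Module A Y]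
    [AddCommGroup Z] [Module A Z] (π : X →ₗ[A] Y) (ι : Y →ₗ[A] X) (π' : X →ₗ[A] Z)
    (ι' : Z →ₗ[A] X) {n : ℕ} (x : ExtSelf X n)
    [Subsingleton (Ext.{u} (ModuleCat.of A Y) (ModuleCat.of A Z) n)] :
    endToExtAlgebra X (ι' ∘ₗ π') * DirectSum.of (ExtSelf X) n x * endToExtAlgebra X (ι ∘ₗ π) =
      0 := by
  have h : ((Ext.mk₀ (ModuleCat.ofHom ι)).comp x (zero_add n)).comp
      (Ext.mk₀ (ModuleCat.ofHom π')) (add_zero n) = 0 :=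
    Subsingleton.elim _ _
  rw [endToExtAlgebra_mul_of_mul, ModuleCat.ofHom_comp, ModuleCat.ofHom_comp, ← Ext.mk₀_comp_mk₀,
    ← Ext.mk₀_comp_mk₀, ← Ext.comp_assoc_of_third_deg_zero,
    Ext.comp_assoc (Ext.mk₀ (ModuleCat.ofHom π)) (Ext.mk₀ (ModuleCat.ofHom ι)) _ (zero_add 0)
      (zero_add n) (by omega), Ext.comp_assoc_of_third_deg_zero (Ext.mk₀ (ModuleCat.ofHom π)),
    ← Ext.comp_assoc_of_third_deg_zero ((Ext.mk₀ (ModuleCat.ofHom ι)).comp x _), h, Ext.zero_comp,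
    Ext.comp_zero, map_zero]

end ExtAlgebra

/-! ### The extension algebra of the standard modules is directed -/

section StandardProj

variable {A : Type u} [Ring A] {Λ : Type u} [PartialOrder Λ] {e : Λ → A}

open Classical in
theorem standardProj_eq (l : Λ) :
    standardProj e l = LinearMap.single A (Standard e) l ∘ₗ LinearMap.proj l := by
  unfold standardProj
  congr!

open Classical in
theorem standardProj_mul_mul (l m : Λ) (g : Module.End A (StandardSum e)) :
    standardProj e m * g * standardProj e l = LinearMap.single A (Standard e) m ∘ₗ
      (LinearMap.proj m ∘ₗ g ∘ₗ LinearMap.single A (Standard e) l) ∘ₗ LinearMap.proj l := by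
  rw [standardProj_eq, standardProj_eq]; rfl

variable (e) in
theorem completeOrthogonalIdempotents_standardProj [Fintype Λ] :
    CompleteOrthogonalIdempotents
      (R := Module.End A (StandardSum e)) (fun l => standardProj e l) := by
  classical
  rw [CompleteOrthogonalIdempotents.iff_ortho_complete]
  constructor
  · intro l m hlm
    refine LinearMap.ext fun x => ?_
    change standardProj e l (standardProj e m x) = 0
    rw [standardProj_eq, standardProj_eq]
    simp [Pi.single_eq_of_ne hlm]
  · refine LinearMap.ext fun x => ?_
    rw [LinearMap.sum_apply]
    simp_rw [standardProj_eq]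
    exact LinearMap.sum_single_apply _ x

end StandardProj

/-- Directedness and the concentration of diagonal corners in degree `0` come from the `Ext`
vanishing; inverses come from `End(Δ_l)`. -/
theorem isDirectedGrading_ext {A : Type u} [Ring A] {Λ : Type u} [Fintype Λ] [PartialOrder Λ]
    {e : Λ → A} (he : ∀ l, IsIdempotentElem (e l)) (hs : IsStandardlyStratified e)
    (hdiv : ∀ l (f : Module.End A (Standard e l)), f ≠ 0 → ∃ g, f * g = 1)
    (hne : ∀ l, Nontrivial (Standard e l)) :
    IsDirectedGrading (extDeg (standardSumCat e)) (extIdem e)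
      (extAlgebraToEnd (standardSumCat e)) := by
  classical
  have hE : ∀ l, extIdem e l = endToExtAlgebra (standardSumCat e) (standardProj e l) :=
    fun _ => rfl
  have hvan : ∀ l m n (x : ExtSelf (standardSumCat e) n), (n = 0 → ¬ l ≤ m) → ¬ l < m →
      extIdem e m * DirectSum.of _ n x * extIdem e l = 0 := by
    intro l m n x h0 hlm
    have := hs.subsingleton_ext he h0 hlm
    rw [hE, hE, standardProj_eq, standardProj_eq]
    exact endToExtAlgebra_mul_of_mul_eq_zero _ _ _ _ x
  have hdiag : ∀ l x, extIdem e l * x * extIdem e l = endToExtAlgebra (standardSumCat e)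
      (standardProj e l * extAlgebraToEnd _ x * standardProj e l) := by
    intro l x
    rw [map_mul, map_mul, ← hE]
    induction x using DirectSum.induction_on with
    | zero => simp
    | of n x =>
      rw [extAlgebraToEnd_of]
      cases n with
      | zero =>
        obtain ⟨f, rfl⟩ := Abelian.Ext.mk₀_bijective _ _ |>.2 x
        rw [extToEnd_mk₀, endToExtAlgebra_apply, ModuleCat.ofHom_hom]
      | succ n =>
        rw [hvan l l (n + 1) x (by omega) (lt_irrefl l), show extToEnd _ (n + 1) x = 0 from rfl,
          map_zero, mul_zero, zero_mul]
    | add x y hx hy => rw [mul_add, add_mul, hx, hy, map_add, map_add, mul_add, add_mul]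
  exact
    { idem := (completeOrthogonalIdempotents_standardProj e).map
        (endToExtAlgebra (standardSumCat e))
      map_eq_zero_iff := extAlgebraToEnd_eq_zero_iff _
      mem_iSup := fun x => by
        induction x using DirectSum.induction_on with
        | zero => exact zero_mem _
        | of n x => exact AddSubgroup.mem_iSup_of_mem n ⟨x, rfl⟩
        | add x y hx hy => exact add_mem hx hy
      mul_mem := by
        rintro n _ l ⟨x, rfl⟩
        exact ⟨_, (of_mul_of_mk₀ _ x).symm⟩
      directed := fun l m hlm x => by
        induction x using DirectSum.induction_on with
        | zero => simp
        | of n x => exact hvan l m n x (fun _ => hlm) fun h => hlm h.le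
        | add x y hx hy => rw [mul_add, add_mul, hx, hy, add_zero]
      diag := fun l x hx => by rw [hdiag, hx, mul_zero, zero_mul, map_zero]
      division := fun l x hx => by
        rw [hdiag] at hx ⊢
        rw [hE, extAlgebraToEnd_endToExtAlgebra, extAlgebraToEnd_endToExtAlgebra]
        rw [standardProj_mul_mul] at hx ⊢
        set f : Module.End A (Standard e l) :=
          LinearMap.proj l ∘ₗ extAlgebraToEnd _ x ∘ₗ LinearMap.single A (Standard e) l with hf
        have hf0 : f ≠ 0 := fun h0 => hx (by
          rw [h0, LinearMap.zero_comp, LinearMap.comp_zero]; exact map_zero _)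
        obtain ⟨g, hg⟩ := hdiv l f hf0
        refine ⟨LinearMap.single A (Standard e) l ∘ₗ g ∘ₗ LinearMap.proj l, ?_⟩
        refine LinearMap.ext fun z => ?_
        have := LinearMap.congr_fun hg (z l)
        rw [standardProj_eq]
        simpa using congrArg (Pi.single l) this
      ne_zero := fun l h0 => by
        have h1 : standardProj e l = 0 := by
          rw [← extAlgebraToEnd_endToExtAlgebra (standardSumCat e) (standardProj e l), ← hE, h0,
            map_zero]
        obtain ⟨z, hz⟩ := exists_ne (0 : Standard e l)
        have h2 := congrFun (LinearMap.congr_fun h1 (Pi.single l z)) l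
        rw [standardProj_eq] at h2
        exact hz (by simpa using h2) }

/-! ### Semisimplicity of the standard modules and the radical -/

theorem DeltaFiltration.pow_smul_eq_zero {A : Type u} [Ring A] {Λ : Type w} {Δ : Λ → Type u} [∀ l, AddCommGroup (Δ l)]
    [∀ l, Module A (Δ l)] {M : Type u} [AddCommGroup M] [Module A M]
    (F : DeltaFiltration (A := A) Δ M) {a : A} (ha : ∀ l (z : Δ l), a • z = 0) (x : M) :
    a ^ F.length • x = 0 := by
  have key : ∀ j ≤ F.length, ∀ x ∈ F.sub j, a ^ j • x = 0 := by
    intro j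
    induction j with
    | zero =>
      intro _ x hx
      rw [F.sub_zero, Submodule.mem_bot] at hx
      rw [hx, smul_zero]
    | succ j ih =>
      intro hj x hx
      obtain ⟨φ⟩ := F.factor ⟨j, hj⟩
      have h0 : a • (Submodule.Quotient.mk ⟨x, hx⟩ :
          F.sub (j + 1) ⧸ (F.sub j).submoduleOf (F.sub (j + 1))) = 0 :=
        φ.injective (by rw [map_smul, map_zero]; exact ha _ _)
      rw [← Submodule.Quotient.mk_smul, Submodule.Quotient.mk_eq_zero] at h0
      rw [pow_succ, mul_smul]
      exact ih (by omega) _ h0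
  exact key _ le_rfl x (by rw [F.sub_length]; trivial)

section SemisimpleTop

variable {k : Type v} [Field k] {A : Type u} [Ring A] [Algebra k A] {Λ : Type u}
  [PartialOrder Λ] {e : Λ → A}

theorem IsQuasiHereditary.nontrivial_standard (h : IsQuasiHereditary k e) (l : Λ) :
    Nontrivial (Standard e l) := by
  by_contra hs
  rw [not_nontrivial_iff_subsingleton] at hs
  exact one_ne_zero ((h.end_standard l).1 (LinearMap.ext fun x => Subsingleton.elim _ _) :
    (1 : k) = 0)

theorem IsQuasiHereditary.exists_mul_eq_one (h : IsQuasiHereditary k e) (l : Λ)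
    (f : Module.End A (Standard e l)) (hf : f ≠ 0) : ∃ g, f * g = 1 := by
  obtain ⟨c, rfl⟩ := (h.end_standard l).2 f
  refine ⟨algebraMap k _ c⁻¹, ?_⟩
  rw [← map_mul, mul_inv_cancel₀ fun hc => hf (by rw [hc, map_zero]), map_one]

/-- If the standard modules are pairwise orthogonal and `Δ ≅ End_A(Δ)` as `End_A(Δ)`-modules, then
the standard modules are one-dimensional. -/
theorem IsQuasiHereditary.exists_smul_eq [Fintype Λ] (h : IsQuasiHereditary k e)
    (hoff : ∀ l m, l ≠ m → ∀ f : Standard e l →ₗ[A] Standard e m, f = 0)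
    (Θ : (A →ₗ[A] StandardSum e) ≃ₗ[Module.End A (StandardSum e)] Module.End A (StandardSum e))
    {l : Λ} {z : Standard e l} (hz : z ≠ 0) (z' : Standard e l) :
    ∃ c : k, algebraMap k A c • z = z' := by
  classical
  let f (y : Standard e l) : A →ₗ[A] StandardSum e :=
    LinearMap.toSpanSingleton A _ (Pi.single l y)
  let s (c : k) : Module.End A (StandardSum e) := LinearMap.single A (Standard e) l ∘ₗ
    algebraMap k (Module.End A (Standard e l)) c ∘ₗ LinearMap.proj l
  -- The map `f y` is fixed by the idempotent of `Δ_l`, so its image under `Θ` lies in the `l`-th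
  -- row of `End(Δ)`, which is `k` since the other entries vanish.
  have hs : ∀ y, ∃ c, Θ (f y) = s c := by
    intro y
    have h1 : standardProj e l • f y = f y := by
      refine LinearMap.ext_ring ?_
      change standardProj e l (f y 1) = f y 1
      rw [standardProj_eq]
      simp [f]
    have h2 : standardProj e l * Θ (f y) = Θ (f y) := by
      rw [← smul_eq_mul, ← map_smul, h1]
    obtain ⟨c, hc⟩ := (h.end_standard l).2
      (LinearMap.proj l ∘ₗ Θ (f y) ∘ₗ LinearMap.single A (Standard e) l)
    refine ⟨c, ?_⟩
    rw [← h2, ← mul_one (standardProj e l * _),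
      ← (completeOrthogonalIdempotents_standardProj e).complete, Finset.mul_sum,
      Finset.sum_eq_single l]
    · rw [standardProj_mul_mul, ← hc]
    · intro m _ hml
      rw [standardProj_mul_mul, hoff m l hml (LinearMap.proj l ∘ₗ _), LinearMap.zero_comp,
        LinearMap.comp_zero]
    · simp
  obtain ⟨c, hc⟩ := hs z
  obtain ⟨c', hc'⟩ := hs z'
  have hc0 : c ≠ 0 := by
    rintro rfl
    have h0 : f z = 0 := Θ.injective (by
      rw [hc, map_zero]
      simp only [s, map_zero, LinearMap.zero_comp, LinearMap.comp_zero])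
    exact hz (by simpa [f] using congrFun (LinearMap.congr_fun h0 1) l)
  have hmul : s (c' / c) * s c = s c' := by
    refine LinearMap.ext fun x => ?_
    simp only [s, Module.End.mul_apply, LinearMap.comp_apply, LinearMap.single_apply,
      LinearMap.proj_apply, Pi.single_eq_same]
    rw [← Module.End.mul_apply, ← map_mul, div_mul_cancel₀ _ hc0]
  have hf : f z' = s (c' / c) • f z := Θ.injective (by
    rw [map_smul, hc, hc', smul_eq_mul, hmul])
  refine ⟨c' / c, ?_⟩
  have h1 := congrFun (LinearMap.congr_fun hf 1) l
  change f z' 1 l = s (c' / c) (f z 1) l at h1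
  simp only [f, s, LinearMap.toSpanSingleton_apply, one_smul, LinearMap.comp_apply,
    LinearMap.single_apply, LinearMap.proj_apply, Pi.single_eq_same,
    Module.algebraMap_end_apply] at h1
  rw [h1, algebraMap_smul]

/-- One factor `a` moves `e_l` into the trace kernel, and each further factor descends one step of
its filtration; hence the exponent length plus one. -/
theorem IsStandardlyStratified.isNilpotent [Fintype Λ] (h : IsStandardlyStratified e)
    (he : CompleteOrthogonalIdempotents e) {a : A} (ha : ∀ l (z : Standard e l), a • z = 0) :
    IsNilpotent a := by
  choose F hF using h.kernel_filtered
  have key : ∀ l, a ^ ((F l).length + 1) * e l = 0 := by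
    intro l
    let y : projModule e l := ⟨e l, Submodule.mem_span_singleton_self _⟩
    have hy : a • y ∈ traceKernel e l := by
      rw [← Submodule.Quotient.mk_eq_zero, Submodule.Quotient.mk_smul]
      exact ha l _
    have := congrArg (fun t : traceKernel e l => ((t : projModule e l) : A))
      ((F l).pow_smul_eq_zero ha ⟨a • y, hy⟩)
    rw [pow_succ, mul_assoc]
    exact this
  refine ⟨∑ l, ((F l).length + 1), ?_⟩
  rw [← mul_one (a ^ _), ← he.complete, Finset.mul_sum]
  refine Finset.sum_eq_zero fun l _ => ?_
  obtain ⟨n, hn⟩ := Nat.exists_eq_add_of_le' (Finset.single_le_sum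
    (f := fun l => (F l).length + 1) (fun _ _ => Nat.zero_le _) (Finset.mem_univ l))
  rw [hn, pow_add, mul_assoc, key, mul_zero]

/-- Scalars are central and each `Δ_l` is spanned over `k` by its generator, so whatever kills the
generators kills `Δ` and is nilpotent. Conversely, the radical kills the semisimple module `Δ`. -/
theorem IsQuasiHereditary.ker_toStandardSum [Fintype Λ] (h : IsQuasiHereditary k e)
    (he : CompleteOrthogonalIdempotents e)
    (hdim : ∀ l (z z' : Standard e l), z ≠ 0 → ∃ c : k, algebraMap k A c • z = z') :
    LinearMap.ker (toStandardSum e) = Ring.jacobson A := by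
  have hsimple : ∀ l, IsSimpleModule A (Standard e l) := fun l => by
    rw [isSimpleModule_iff_toSpanSingleton_surjective]
    exact ⟨h.nontrivial_standard l, fun z hz z' => (hdim l z z' hz).imp' _ fun _ hc => hc⟩
  refine le_antisymm ?_ ?_
  · have hgen : ∀ l, toStandardSum e 1 l ≠ 0 := by
      intro l h0
      have := h.nontrivial_standard l
      obtain ⟨z, hz⟩ := exists_ne (0 : Standard e l)
      obtain ⟨y, rfl⟩ := (traceKernel e l).mkQ_surjective z
      refine hz ?_
      rw [← toProjModule_coe (he.idem l) y, ← toStandardSum_apply, ← mul_one (y : A),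
        ← smul_eq_mul, map_smul, Pi.smul_apply, h0, smul_zero]
    have hann : ∀ a ∈ LinearMap.ker (toStandardSum e), ∀ l (z : Standard e l), a • z = 0 := by
      intro a ha l z
      obtain ⟨c, rfl⟩ := hdim l _ z (hgen l)
      rw [← mul_smul, ← Algebra.commutes, mul_smul]
      have : a • toStandardSum e 1 l = 0 := by
        rw [← Pi.smul_apply, ← map_smul, smul_eq_mul, mul_one, LinearMap.mem_ker.1 ha]; rfl
      rw [this, smul_zero]
    intro a ha
    rw [← Ideal.jacobson_bot, Ideal.mem_jacobson_iff]
    intro y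
    -- The kernel is a left ideal, so every `y * a` is nilpotent and `1 + y * a` is a unit.
    obtain ⟨u, hu⟩ := (h.isNilpotent he
      (hann (y * a) (Submodule.smul_mem _ y ha))).isUnit_one_add
    refine ⟨↑u⁻¹, ?_⟩
    rw [Ideal.mem_bot, sub_eq_zero, mul_assoc, ← mul_add_one, add_comm, ← hu, Units.inv_mul]
  · intro x hx
    have h0 : Module.jacobson A (StandardSum e) = ⊥ :=
      Module.jacobson_pi_eq_bot A _ fun l => IsSemisimpleModule.jacobson_eq_bot A _
    have := Module.le_comap_jacobson (toStandardSum e) hx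
    rw [h0] at this
    simpa using this

end SemisimpleTop

/-! ### The main theorem -/

theorem proposition2p16 {k : Type v} [Field k] [IsAlgClosed k]
    {A : Type u} [Ring A] [Algebra k A] [Module.Finite k A]
    {Λ : Type u} [Fintype Λ] [PartialOrder Λ] (e : Λ → A)
    (hbasic : IsBasicFamily e)
    (hqh : IsQuasiHereditary k e)
    (hlin : ∀ l, IsLinearlyFiltered e (Standard e l)) :
    -- the two formulations of the conclusion are equivalent
    (GradedIso (ExtAlgebra (standardSumCat e))
        (degreeZeroDeg (extDeg (standardSumCat e)))
        (standardSumDeg (extDeg (standardSumCat e)) (extIdem e)) ↔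
      ∀ l m, l ≠ m → ∀ f : Standard e l →ₗ[A] Standard e m, f = 0) ∧
    -- and they hold if the direct sum of the standard modules of the extension algebra is linear
    (Nonempty (LinearProjectiveResolution (extDeg (standardSumCat e))
        (StandardSum (extIdem e)) (standardSumDeg (extDeg (standardSumCat e)) (extIdem e))) →
      GradedIso (ExtAlgebra (standardSumCat e))
        (degreeZeroDeg (extDeg (standardSumCat e)))
        (standardSumDeg (extDeg (standardSumCat e)) (extIdem e)) ∧
      (∀ l m, l ≠ m → ∀ f : Standard e l →ₗ[A] Standard e m, f = 0) ∧
      (Nonempty ((A →ₗ[A] StandardSum e) ≃ₗ[Module.End A (StandardSum e)]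
          Module.End A (StandardSum e)) →
        Nonempty (StandardSum e ≃ₗ[A] (A ⧸ Ring.jacobson A)))) := by
  classical
  have he := hbasic.complete
  have hΓ := isDirectedGrading_ext he.idem hqh.toIsStandardlyStratified hqh.exists_mul_eq_one
    hqh.nontrivial_standard
  have hE : ∀ l m x, extAlgebraToEnd (standardSumCat e) (extIdem e m * x * extIdem e l) =
      standardProj e m * extAlgebraToEnd _ x * standardProj e l := fun l m x => by
    rw [map_mul, map_mul]
    exact congrArg₂ _ (congrArg (· * extAlgebraToEnd _ x) (extAlgebraToEnd_endToExtAlgebra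
      (standardSumCat e) (standardProj e m))) (extAlgebraToEnd_endToExtAlgebra
      (standardSumCat e) (standardProj e l))
  have hiff : (∀ l m, l ≠ m → ∀ x,
      extAlgebraToEnd (standardSumCat e) (extIdem e m * x * extIdem e l) = 0) ↔
      ∀ l m, l ≠ m → ∀ f : Standard e l →ₗ[A] Standard e m, f = 0 := by
    refine forall₃_congr fun l m _ => ⟨fun h f => ?_, fun h x => ?_⟩
    · refine LinearMap.ext fun z => ?_
      have h1 := h (endToExtAlgebra (standardSumCat e)
        (LinearMap.single A (Standard e) m ∘ₗ f ∘ₗ LinearMap.proj l))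
      rw [hE, extAlgebraToEnd_endToExtAlgebra, standardProj_mul_mul] at h1
      have h2 := congrFun (LinearMap.congr_fun h1 (Pi.single l z)) m
      simp only [LinearMap.comp_apply, LinearMap.single_apply, LinearMap.proj_apply,
        Pi.single_eq_same] at h2
      exact h2
    · rw [hE, standardProj_mul_mul, h (LinearMap.proj m ∘ₗ _), LinearMap.zero_comp,
        LinearMap.comp_zero]
  have hiso := fun hoff => hΓ.gradedIso (hiff.2 hoff)
  refine ⟨⟨?_, hiso⟩, ?_⟩
  · rintro ⟨φ, -⟩
    exact hiff.1 fun l m hlm x => hΓ.map_eq_zero_of_injective (φ := φ.toLinearMap) φ.injective hlm x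
  · rintro ⟨L⟩
    have hoff := hiff.1 fun l m hlm x => hΓ.map_eq_zero_of_linearProjectiveResolution L hlm x
    refine ⟨hiso hoff, hoff, ?_⟩
    rintro ⟨Θ⟩
    have hker := hqh.ker_toStandardSum he fun l z z' hz => hqh.exists_smul_eq hoff Θ hz z'
    exact ⟨((Submodule.quotEquivOfEq _ _ hker.symm).trans
      ((toStandardSum e).quotKerEquivOfSurjective
        (toStandardSum_surjective he.toOrthogonalIdempotents))).symm⟩
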